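/- Let $n>3t$. Consider deterministic message-passing protocols for $n$ processors: each processor has an initial state determined by its input; in a step it sends to every processor at most one message determined by its current state, receives at most one message from every processor, and moves to a new state determined by its state and the messages received; states (which may record a round number) determine whether an output is produced, and the output of a processor is the first value that it produces. A run of $P$ in the synchronous system $\mathrm{MOB}tt$ with inputs $x$ and corrupted set $B$, $|B|\le t$: the adversary first replaces the inputs of the processors in $B$ by arbitrary values; then all processors execute $P$ in synchronous rounds, where in each round the adversary chooses a set of at most $t$ processors (possibly a different one in each round) and may remove some or all of the messages that these send in this round. A run of $Q$ in the $t$-resilient asynchronous Byzantine system with inputs $x$ and Byzantine set $B$, $|B|\le t$: the processors outside $B$ (the correct ones) start with their own inputs, take infinitely many steps of $Q$ at times chosen by a scheduler, and every message between correct processors is delivered, unaltered and exactly once, after an arbitrary finite delay; the messages received from processors in $B$ are arbitrary. Then, for deterministic protocols, the two systems are equivalent in the following sense. 1. Every $\mathrm{MOB}tt$ run is an asynchronous Byzantine run: for every protocol $P$, every run $\sigma$ of $P$ in $\mathrm{MOB}tt$ with inputs $x$ and corrupted set $B$, and every number $R$ of rounds, there is a run of the same protocol $P$ in the asynchronous Byzantine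 system, with inputs $x$ and Byzantine set $B$, whose first $R$ time steps are the first $R$ rounds of $\sigma$ (in each of them every processor takes a step, receives the same messages and has the same state as in $\sigma$). 2. For every protocol $P$ there is a protocol $Q$ that, in the asynchronous Byzantine system, simulates $P$ in $\mathrm{MOB}tt$: the state of $Q$ at a processor determines a number of simulated rounds and a simulated state of $P$, such that for every asynchronous Byzantine run of $Q$ with inputs $x$ and Byzantine set $B$ there is one run $\sigma$ of $P$ in $\mathrm{MOB}tt$ with inputs $x$ and corrupted set $B$ (in which no message of a processor to itself is removed) for which every correct processor passes, round after round and through all rounds, through exactly the states that it has in $\sigma$, and outputs a value $o$ if and only if it outputs $o$ in $\sigma$. -/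

import Mathlib

universe u

/-- A deterministic message-passing protocol for `n` processors with inputs in `V` and outputs
in `O`. In one step, processor `i` in state `s` sends `send i s j` to every processor `j`
(`none` means that no message is sent to `j`), receives at most one message from every processor,
and moves to the state `step i s M`, where `M j` is the message received from `j` (if any).
The state may contain the number of steps taken so far, so that transition functions and messages
that depend on a round number are covered. -/
structure Protocol (n : ℕ) (V O : Type u) where
  State : Type u
  Msg : Type u
  init : Fin n → V → State
  send : Fin n → State → Fin n → Option Msg
  step : Fin n → State → (Fin n → Option Msg) → State
  output : Fin n → State → Option O

/-- Along the sequence `st` of its states, processor `i` outputs `o`: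
`o` is the first value that it produces. -/
def Protocol.Outputs {n : ℕ} {V O : Type u} (P : Protocol n V O) (i : Fin n)
    (st : ℕ → P.State) (o : O) : Prop :=
  ∃ k, P.output i (st k) = some o ∧ ∀ l < k, P.output i (st l) = none

/-- A run of `P` in the synchronous mobile omission system: the processors receive the inputs `x`,
of which the adversary replaces those of the at most `t` processors in `B`. In each round `r`
it chooses a set `mobile r` of at most `t` processors and removes some of the messages sent by
them: `(j, i) ∈ lost r` means that the message from `j` to `i` is removed in round `r`.
All processors follow the protocol, and `state r i` is the state of `i` after `r` rounds. -/
structure MOBRun {n : ℕ} {V O : Type u} (P : Protocol n V O) (t : ℕ) (x : Fin n → V)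
    (B : Finset (Fin n)) where
  card_le : B.card ≤ t
  /-- the inputs after the replacement -/
  input : Fin n → V
  input_eq : ∀ i, i ∉ B → input i = x i
  mobile : ℕ → Finset (Fin n)
  mobile_card_le : ∀ r, (mobile r).card ≤ t
  lost : ℕ → Finset (Fin n × Fin n)
  mem_mobile_of_lost : ∀ r j i, (j, i) ∈ lost r → j ∈ mobile r
  state : ℕ → Fin n → P.State
  state_zero : ∀ i, state 0 i = P.init i (input i)
  state_succ : ∀ r i, state (r + 1) i = P.step i (state r i)
    (fun j => if (j, i) ∈ lost r then none else P.send j (state r j) i)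

/-- The messages received by `i` in round `r` of a synchronous run. -/
def MOBRun.received {n : ℕ} {V O : Type u} {P : Protocol n V O} {t : ℕ} {x : Fin n → V}
    {B : Finset (Fin n)} (σ : MOBRun P t x B) (r : ℕ) (i j : Fin n) : Option P.Msg :=
  if (j, i) ∈ σ.lost r then none else P.send j (σ.state r j) i

/-- An admissible run of `Q` with inputs `x` in the `t`-resilient asynchronous system with the set
`B` of (at most `t`) Byzantine processors. Time is the discrete time of an outside observer, and
the scheduler chooses the set `active k` of the processors that take a step at time `k`. `recv k i j`
is the message (if any) that `i` receives from `j` at time `k`. What arrives from a Byzantine sender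
is arbitrary, and nothing is required of the states of Byzantine processors. Every message that a
correct processor `j` sends to a correct processor `i` at time `s` is delivered exactly once, at the
time `deliveryTime j i s`, after an arbitrary finite delay and in any order. -/
structure ByzRun {n : ℕ} {V O : Type u} (Q : Protocol n V O) (t : ℕ) (x : Fin n → V)
    (B : Finset (Fin n)) where
  card_le : B.card ≤ t
  active : ℕ → Finset (Fin n)
  recv : ℕ → Fin n → Fin n → Option Q.Msg
  deliveryTime : Fin n → Fin n → ℕ → ℕ
  state : ℕ → Fin n → Q.State
  /-- correct processors start with their own inputs and follow the protocol -/
  state_zero : ∀ i, i ∉ B → state 0 i = Q.init i (x i)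
  state_active : ∀ i, i ∉ B → ∀ k, i ∈ active k →
    state (k + 1) i = Q.step i (state k i) (recv k i)
  state_idle : ∀ i, i ∉ B → ∀ k, i ∉ active k → state (k + 1) i = state k i
  /-- correct processors take infinitely many steps -/
  fair : ∀ i, i ∉ B → ∀ k, ∃ l, k ≤ l ∧ i ∈ active l
  /-- every message between correct processors is eventually delivered, unaltered -/
  delivered : ∀ i j, i ∉ B → j ∉ B → ∀ s m, j ∈ active s → Q.send j (state s j) i = some m →
    s ≤ deliveryTime j i s ∧ i ∈ active (deliveryTime j i s) ∧
      recv (deliveryTime j i s) i j = some m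
  /-- a step delivers at most one message of each channel -/
  delivered_inj : ∀ i j, i ∉ B → j ∉ B → ∀ s s',
    j ∈ active s → Q.send j (state s j) i ≠ none →
    j ∈ active s' → Q.send j (state s' j) i ≠ none →
    deliveryTime j i s = deliveryTime j i s' → s = s'
  /-- between correct processors, only messages that were sent are received, each only once -/
  genuine : ∀ i j, i ∉ B → j ∉ B → ∀ k m, i ∈ active k → recv k i j = some m →
    ∃ s, j ∈ active s ∧ Q.send j (state s j) i = some m ∧ deliveryTime j i s = k

/-- The first `R` rounds of the synchronous run `σ` are the first `R` time steps of the asynchronous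
run `ρ`: in each of them all processors take a step, receive the same messages as in `σ`, and all
are in the same states as in `σ`. -/
def ByzRun.StartsWith {n : ℕ} {V O : Type u} {P : Protocol n V O} {t : ℕ} {x : Fin n → V}
    {B : Finset (Fin n)} (ρ : ByzRun P t x B) (σ : MOBRun P t x B) (R : ℕ) : Prop :=
  (∀ r < R, ∀ i, i ∈ ρ.active r) ∧
  (∀ r < R, ∀ i j, ρ.recv r i j = σ.received r i j) ∧
  (∀ r ≤ R, ∀ i, ρ.state r i = σ.state r i)

/-- The protocol `Q`, run in the `t`-resilient asynchronous Byzantine system, simulates the protocol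
`P` of the synchronous mobile omission system. A state `q` of `Q` at processor `i` determines the
number `rnd i q` of simulated rounds and the simulated state `sm i q` of `P`. For every asynchronous
run with Byzantine set `B` there is a single synchronous run of `P` with the same inputs, in which
only inputs of processors in `B` are replaced (and no message of a processor to itself is removed),
such that every correct processor goes, round after round, through all its states in that run
and produces its output in that run. -/
def Simulates {n : ℕ} {V O : Type u} (Q P : Protocol n V O) (t : ℕ) : Prop :=
  ∃ (rnd : Fin n → Q.State → ℕ) (sm : Fin n → Q.State → P.State),
    ∀ (x : Fin n → V) (B : Finset (Fin n)) (ρ : ByzRun Q t x B),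
      ∃ σ : MOBRun P t x B,
        (∀ r i, (i, i) ∉ σ.lost r) ∧
        ∀ i, i ∉ B →
          (∀ k, sm i (ρ.state k i) = σ.state (rnd i (ρ.state k i)) i) ∧
          Monotone (fun k => rnd i (ρ.state k i)) ∧
          (∀ r, ∃ k, rnd i (ρ.state k i) = r) ∧
          (∀ o, Q.Outputs i (fun k => ρ.state k i) o ↔ P.Outputs i (fun r => σ.state r i) o)

/-! Within a finite prefix, a message lost in a synchronous round cannot be told apart from a late
one. Delaying the lost messages of the first `R` rounds, and all later messages, by `R` steps gives
an admissible asynchronous run, in which Byzantine processors merely lie about their inputs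
(`MOBRun.exists_byzRun`).

For the converse, no state of `P` is ever sent: processors broadcast inputs and the sets of
processors accepted in each phase, and everybody recomputes all states from this layered graph.
Reliable broadcast by echo and ready quorums makes correct processors agree on every proposal, even
a Byzantine one (`ByzRun.delivered_unique`, `ByzRun.delivered_total`, `ByzRun.delivered_of_writes`).
Accepted proposals refer only to accepted ones, so a vertex determines its whole past
(`simState_local`), and partial knowledge already yields the right state in one run common to all
(`ByzRun.simulated_eq`). A Byzantine processor can influence only its input and which messages get
through.

After a single phase, different receivers could miss different senders, too many altogether. After
three phases all receivers share at least `n - t` senders (`exists_common_core`), so the losses of a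
simulated round are blamed on at most `t` processors. -/

open Filter

/-! ### Synchronous runs as prefixes of asynchronous runs -/

/-- All processors take a step at every time. The messages of the first `R` rounds are received as
in the synchronous run `σ`; those that `σ` loses and all later ones are delayed by `R` steps. -/
def MOBRun.delayedState {n : ℕ} {V O : Type u} {P : Protocol n V O} {t : ℕ} {x : Fin n → V}
    {B : Finset (Fin n)} (σ : MOBRun P t x B) (R : ℕ) : ℕ → Fin n → P.State
  | 0 => σ.state 0
  | k + 1 => fun i => P.step i (σ.delayedState R k i) (fun j =>
      if k < R then σ.received k i j
      else if k - R < R ∧ (j, i) ∉ σ.lost (k - R) then none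
      else P.send j (σ.delayedState R (k - R) j) i)
termination_by k => k
decreasing_by all_goals omega

theorem MOBRun.delayedState_eq {n : ℕ} {V O : Type u} {P : Protocol n V O} {t : ℕ} {x : Fin n → V}
    {B : Finset (Fin n)} (σ : MOBRun P t x B) (R k : ℕ) (hk : k ≤ R) :
    σ.delayedState R k = σ.state k := by
  induction k with
  | zero => rw [MOBRun.delayedState]
  | succ k ih =>
    funext i
    rw [MOBRun.delayedState, σ.state_succ, ih (by omega)]
    simp only [if_pos (show k < R by omega)]
    rfl

theorem MOBRun.exists_byzRun {n : ℕ} {V O : Type u} {P : Protocol n V O} {t : ℕ} {x : Fin n → V}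
    {B : Finset (Fin n)} (σ : MOBRun P t x B) (R : ℕ) :
    ∃ ρ : ByzRun P t x B, ρ.StartsWith σ R := by
  refine ⟨{
    card_le := σ.card_le
    active := fun _ => Finset.univ
    recv := fun k i j =>
      if k < R then σ.received k i j
      else if k - R < R ∧ (j, i) ∉ σ.lost (k - R) then none
      else P.send j (σ.delayedState R (k - R) j) i
    deliveryTime := fun j i s => if s < R ∧ (j, i) ∉ σ.lost s then s else s + R
    state := σ.delayedState R
    state_zero := ?_
    state_active := ?_
    state_idle := ?_
    fair := ?_
    delivered := ?_
    delivered_inj := ?_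
    genuine := ?_ }, ?_, ?_, ?_⟩
  · intro i hi
    rw [σ.delayedState_eq R 0 (Nat.zero_le _), σ.state_zero, σ.input_eq i hi]
  · intro i _ k _
    rw [MOBRun.delayedState]
  · intro i _ k hk
    simp at hk
  · intro i _ k
    exact ⟨k, le_rfl, Finset.mem_univ _⟩
  · intro i j _ _ s m _ hs
    by_cases h : s < R ∧ (j, i) ∉ σ.lost s
    · rw [σ.delayedState_eq R s h.1.le] at hs
      simp [h, MOBRun.received, hs]
    · simp only [if_neg h, Finset.mem_univ, true_and]
      refine ⟨by omega, ?_⟩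
      rw [if_neg (by omega), Nat.add_sub_cancel, if_neg h, hs]
  · intro i j _ _ s s' _ _ _ _ h
    -- Punctual messages arrive before time `R`, delayed ones at or after it, so the two kinds never
    -- collide.
    split_ifs at h <;> omega
  · intro i j _ _ k m _ h
    by_cases hk : k < R
    · rw [if_pos hk, MOBRun.received] at h
      split_ifs at h with hl
      refine ⟨k, Finset.mem_univ _, ?_, ?_⟩
      · rw [σ.delayedState_eq R k hk.le, h]
      · simp [hk, hl]
    · rw [if_neg hk] at h
      split_ifs at h with hl
      refine ⟨k - R, Finset.mem_univ _, h, ?_⟩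
      simp only [if_neg hl]
      omega
  · intro r _ i
    exact Finset.mem_univ _
  · intro r hr i j
    simp [hr]
  · intro r hr i
    simp [σ.delayedState_eq R r hr]

/-! ### Quorums -/

open Classical in
/-- The number of processors with the property `p`. -/
noncomputable def count {n : ℕ} (p : Fin n → Prop) : ℕ := (Finset.univ.filter p).card

theorem count_eq_card {n : ℕ} (p : Fin n → Prop) [DecidablePred p] :
    count p = (Finset.univ.filter p).card := by
  unfold count
  congr

theorem count_mono {n : ℕ} {p q : Fin n → Prop} (h : ∀ l, p l → q l) : count p ≤ count q := by
  classical
  rw [count_eq_card, count_eq_card]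
  exact Finset.card_le_card (Finset.monotone_filter_right _ fun l _ => h l)

theorem le_count {n t : ℕ} {B : Finset (Fin n)} (hB : B.card ≤ t) {p : Fin n → Prop}
    (h : ∀ l, l ∉ B → p l) : n - t ≤ count p := by
  classical
  have h1 : Bᶜ ⊆ Finset.univ.filter p := fun l hl => by
    simpa using h l (by simpa using hl)
  have h2 := Finset.card_le_card h1
  rw [Finset.card_compl, Fintype.card_fin] at h2
  rw [count_eq_card]
  omega

theorem count_le_add {n t : ℕ} {B : Finset (Fin n)} (hB : B.card ≤ t) (p : Fin n → Prop) :
    count p ≤ count (fun l => p l ∧ l ∉ B) + t := by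
  classical
  have h1 : Finset.univ.filter p ⊆ Finset.univ.filter (fun l => p l ∧ l ∉ B) ∪ B := fun l hl => by
    simp only [Finset.mem_filter, Finset.mem_univ, true_and, Finset.mem_union] at hl ⊢
    tauto
  have h2 := (Finset.card_le_card h1).trans (Finset.card_union_le _ _)
  rw [count_eq_card, count_eq_card]
  omega

theorem count_pos {n : ℕ} {p : Fin n → Prop} (h : 0 < count p) : ∃ l, p l := by
  classical
  obtain ⟨l, hl⟩ := Finset.card_pos.1 h
  exact ⟨l, by simpa using hl⟩

theorem exists_correct {n t : ℕ} {B : Finset (Fin n)} (hB : B.card ≤ t) {p : Fin n → Prop}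
    (h : t < count p) : ∃ l, l ∉ B ∧ p l := by
  have h1 := count_le_add hB p
  obtain ⟨l, hl⟩ := count_pos (p := fun l => p l ∧ l ∉ B) (by omega)
  exact ⟨l, hl.2, hl.1⟩

theorem count_add_le {n : ℕ} (p q : Fin n → Prop) :
    count p + count q ≤ n + count (fun l => p l ∧ q l) := by
  classical
  have h1 := Finset.card_union_add_card_inter (Finset.univ.filter p) (Finset.univ.filter q)
  have h2 := Finset.card_le_univ (Finset.univ.filter p ∪ Finset.univ.filter q)
  rw [Fintype.card_fin] at h2
  rw [← Finset.filter_and] at h1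
  rw [count_eq_card, count_eq_card, count_eq_card]
  omega

/-- Two quorums overlap in at least `n - 2 * t > t` processors, too many to be all Byzantine. -/
theorem exists_correct_of_quorums {n t : ℕ} (hn : 3 * t < n) {B : Finset (Fin n)}
    (hB : B.card ≤ t) {p q : Fin n → Prop} (hp : n - t ≤ count p) (hq : n - t ≤ count q) :
    ∃ l, l ∉ B ∧ p l ∧ q l :=
  exists_correct hB (by have := count_add_le p q; omega)

/-- The receivers after three phases of collecting `n - t` vertices have a common core. -/
theorem exists_common_core {n t : ℕ} (hn : 3 * t < n) (E₁ E₂ E₃ : Fin n → Finset (Fin n))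
    (h₁ : ∀ j, n - t ≤ (E₁ j).card) (h₂ : ∀ j, n - t ≤ (E₂ j).card)
    (h₃ : ∀ j, n - t ≤ (E₃ j).card) :
    ∃ C : Finset (Fin n), n - t ≤ C.card ∧
      ∀ j, C ⊆ (E₃ j).biUnion fun a => (E₂ a).biUnion E₁ := by
  -- Double counting: there are at least `n * (n - t)` pairs with `b ∈ E₂ a`, so some `b` lies in
  -- `E₂ a` for at least `n - t` of the `a`. Its set `E₁ b` is the core.
  obtain ⟨b, hb⟩ : ∃ b, n - t ≤ (Finset.univ.filter fun a => b ∈ E₂ a).card := by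
    by_contra! hcon
    have h := Finset.sum_card_bipartiteAbove_eq_sum_card_bipartiteBelow
      (s := (Finset.univ : Finset (Fin n))) (t := (Finset.univ : Finset (Fin n)))
      (fun a b => b ∈ E₂ a)
    have hl : n * (n - t) ≤ ∑ a : Fin n,
        ((Finset.univ : Finset (Fin n)).bipartiteAbove (fun a b => b ∈ E₂ a) a).card := by
      have := Finset.card_nsmul_le_sum (Finset.univ : Finset (Fin n)) (fun a =>
        ((Finset.univ : Finset (Fin n)).bipartiteAbove (fun a b => b ∈ E₂ a) a).card) (n - t)
        (fun a _ => by simpa [Finset.bipartiteAbove] using h₂ a)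
      simpa using this
    have hr : ∑ b : Fin n,
        ((Finset.univ : Finset (Fin n)).bipartiteBelow (fun a b => b ∈ E₂ a) b).card
        < ∑ _b : Fin n, (n - t) :=
      Finset.sum_lt_sum_of_nonempty ⟨⟨0, by omega⟩, Finset.mem_univ _⟩ fun b _ => hcon b
    simp only [Finset.sum_const, Finset.card_univ, Fintype.card_fin, smul_eq_mul] at hr
    omega
  refine ⟨E₁ b, h₁ b, fun j => ?_⟩
  -- The intersection is nonempty because `2 * (n - t) > n`.
  have hne : (E₃ j ∩ Finset.univ.filter fun a => b ∈ E₂ a).Nonempty := by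
    rw [← Finset.card_pos]
    have h1 := Finset.card_union_add_card_inter (E₃ j) (Finset.univ.filter fun a => b ∈ E₂ a)
    have h2 := Finset.card_le_univ (E₃ j ∪ Finset.univ.filter fun a => b ∈ E₂ a)
    rw [Fintype.card_fin] at h2
    have := h₃ j
    omega
  obtain ⟨a, ha⟩ := hne
  simp only [Finset.mem_inter, Finset.mem_filter, Finset.mem_univ, true_and] at ha
  intro c hc
  simp only [Finset.mem_biUnion]
  exact ⟨a, ha.1, b, ha.2, hc⟩

/-! ### The simulating protocol

Every processor keeps write-once registers and sends all of them in every step. The registers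
implement reliable broadcast: `prop k` holds its own proposal for phase `k`, `echo j k` and
`ready j k` its support for a proposal of `j` for phase `k`. The proposal for phase `0` is an
input, that for phase `k + 1` is a set of at least `n - t` processors whose proposals for phase `k`
were accepted. Three phases simulate one synchronous round. -/

/-- The names of the registers. -/
inductive Slot (n : ℕ) : Type
  | prop (k : ℕ)
  | echo (j : Fin n) (k : ℕ)
  | ready (j : Fin n) (k : ℕ)

/-- Proposals: inputs or sets of processors. -/
abbrev Proposal (n : ℕ) (V : Type u) : Type u := V ⊕ Finset (Fin n)

/-- The register values heard from each processor. -/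
abbrev Heard (n : ℕ) (V : Type u) : Type u := Fin n → Slot n → Set (Proposal n V)

/-- Reliable delivery of the proposal `v` of `j` for phase `k`. -/
def Delivered {n : ℕ} {V : Type u} (t : ℕ) (h : Heard n V) (k : ℕ) (j : Fin n)
    (v : Proposal n V) : Prop :=
  n - t ≤ count fun l => v ∈ h l (.ready j k)

/-- A delivered proposal is accepted when everything that it refers to is accepted. -/
def Accepted {n : ℕ} {V : Type u} (t : ℕ) (h : Heard n V) : ℕ → Fin n → Proposal n V → Prop
  | 0, j, v => Delivered t h 0 j v ∧ ∃ a, v = .inl a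
  | k + 1, j, v => Delivered t h (k + 1) j v ∧
      ∃ A : Finset (Fin n), v = .inr A ∧ n - t ≤ A.card ∧ j ∈ A ∧ ∀ b ∈ A, ∃ w, Accepted t h k b w

/-- The values that processor `i` with input `a` may write into a register. -/
def enabled {n : ℕ} {V : Type u} (t : ℕ) (i : Fin n) (a : V) (h : Heard n V) :
    Slot n → Set (Proposal n V)
  | .prop 0 => {.inl a}
  | .prop (k + 1) => {v | ∃ A : Finset (Fin n), v = .inr A ∧ n - t ≤ A.card ∧ i ∈ A ∧
      ∀ b ∈ A, ∃ w, Accepted t h k b w}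
  | .echo j k => h j (.prop k)
  | .ready j k => {v | n - t ≤ (count fun l => v ∈ h l (.echo j k)) ∨
      t < count fun l => v ∈ h l (.ready j k)}

open Classical in
/-- An element of the set `S`, if there is one. -/
noncomputable def pick {α : Type*} (S : Set α) : Option α :=
  if h : S.Nonempty then some h.some else none

theorem mem_of_pick {α : Type*} {S : Set α} {v : α} (h : pick S = some v) : v ∈ S := by
  unfold pick at h
  split_ifs at h with hS
  obtain rfl := Option.some.inj h
  exact hS.some_mem

theorem pick_ne_none {α : Type*} {S : Set α} (h : S.Nonempty) : pick S ≠ none := by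
  simp [pick, h]

open Classical in
/-- The input of `j` according to `h`, with default `d j`. -/
noncomputable def inputOf {n : ℕ} {V : Type u} (t : ℕ) (h : Heard n V) (d : Fin n → V)
    (j : Fin n) : V :=
  if hj : ∃ a, Accepted t h 0 j (.inl a) then hj.choose else d j

open Classical in
/-- The set proposed by `j` for phase `k` according to `h`, with all processors as default. -/
noncomputable def edges {n : ℕ} {V : Type u} (t : ℕ) (h : Heard n V) (k : ℕ) (j : Fin n) :
    Finset (Fin n) :=
  if hj : ∃ A, Accepted t h k j (.inr A) then hj.choose else Finset.univ

/-- The processors whose messages reach `j` in the simulated round `r`. -/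
noncomputable def reach {n : ℕ} {V : Type u} (t : ℕ) (h : Heard n V) (r : ℕ) (j : Fin n) :
    Finset (Fin n) :=
  (edges t h (3 * r + 3) j).biUnion fun a =>
    (edges t h (3 * r + 2) a).biUnion (edges t h (3 * r + 1))

/-- The simulated states. -/
noncomputable def simState {n : ℕ} {V O : Type u} (P : Protocol n V O) (t : ℕ) (h : Heard n V)
    (d : Fin n → V) : ℕ → Fin n → P.State
  | 0 => fun j => P.init j (inputOf t h d j)
  | r + 1 => fun j => P.step j (simState P t h d r j) fun l =>
      if l ∈ reach t h r j then P.send l (simState P t h d r l) j else none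

/-- The states of the simulating protocol. -/
structure SimulatorState (n : ℕ) (V : Type u) : Type u where
  input : V
  own : Slot n → Option (Proposal n V)
  heard : Heard n V
  round : ℕ

/-- The knowledge after the receipt of the registers `M`. -/
def merge {n : ℕ} {V : Type u} (h : Heard n V)
    (M : Fin n → Option (Slot n → Option (Proposal n V))) : Heard n V :=
  fun j s => h j s ∪ {v | ∃ m, M j = some m ∧ m s = some v}

open Classical in
/-- A step of the simulating protocol. -/
noncomputable def SimulatorState.next {n : ℕ} {V : Type u} (t : ℕ) (i : Fin n)
    (q : SimulatorState n V) (M : Fin n → Option (Slot n → Option (Proposal n V))) :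
    SimulatorState n V where
  input := q.input
  own s := (q.own s).or (pick (enabled t i q.input (merge q.heard M) s))
  heard := merge q.heard M
  round := if ∃ v, Accepted t (merge q.heard M) (3 * (q.round + 1)) i v then q.round + 1
    else q.round

/-- The simulated state of `P`. -/
noncomputable def SimulatorState.simulated {n : ℕ} {V O : Type u} (P : Protocol n V O) (t : ℕ)
    (i : Fin n) (q : SimulatorState n V) : P.State :=
  simState P t q.heard (fun _ => q.input) q.round i

/-- The simulating protocol. -/
noncomputable def simulator {n : ℕ} {V O : Type u} (P : Protocol n V O) (t : ℕ) :
    Protocol n V O where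
  State := SimulatorState n V
  Msg := Slot n → Option (Proposal n V)
  init _ a := { input := a, own := fun _ => none, heard := fun _ _ => ∅, round := 0 }
  send _ q _ := some q.own
  step i q M := q.next t i M
  output i q := P.output i (q.simulated P t i)

/-! ### Monotonicity and continuity of acceptance -/

theorem Delivered.mono {n : ℕ} {V : Type u} {t : ℕ} {h h' : Heard n V} (hh : h ≤ h') {k : ℕ}
    {j : Fin n} {v : Proposal n V} (H : Delivered t h k j v) : Delivered t h' k j v :=
  le_trans (b := count fun l => v ∈ h l (.ready j k)) H (count_mono fun l hl => hh l _ hl)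

theorem Accepted.delivered {n : ℕ} {V : Type u} {t : ℕ} {h : Heard n V} {k : ℕ}
    {j : Fin n} {v : Proposal n V} (H : Accepted t h k j v) : Delivered t h k j v := by
  cases k <;> exact H.1

theorem Accepted.mono {n : ℕ} {V : Type u} {t : ℕ} {h h' : Heard n V} (hh : h ≤ h') {k : ℕ}
    {j : Fin n} {v : Proposal n V} (H : Accepted t h k j v) : Accepted t h' k j v := by
  induction k generalizing j v with
  | zero => exact ⟨H.1.mono hh, H.2⟩
  | succ k ih =>
    obtain ⟨hd, A, hv, hA, hj, hb⟩ := H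
    exact ⟨hd.mono hh, A, hv, hA, hj, fun b hbA => (hb b hbA).imp fun w hw => ih hw⟩

theorem enabled_mono {n : ℕ} {V : Type u} {t : ℕ} {i : Fin n} {a : V} {h h' : Heard n V}
    (hh : h ≤ h') (s : Slot n) : enabled t i a h s ⊆ enabled t i a h' s := by
  intro v hv
  match s with
  | .prop 0 => exact hv
  | .prop (k + 1) =>
    obtain ⟨A, hA, hc, hi, hb⟩ := hv
    exact ⟨A, hA, hc, hi, fun b hbA => (hb b hbA).imp fun w hw => hw.mono hh⟩
  | .echo j k => exact hh _ _ hv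
  | .ready j k =>
    exact hv.imp (fun H => H.trans (count_mono fun l hl => hh l _ hl))
      (fun H => H.trans_le (count_mono fun l hl => hh l _ hl))

/-- The union of a sequence of knowledge. -/
def limitHeard {n : ℕ} {V : Type u} (h : ℕ → Heard n V) : Heard n V :=
  fun j s => {v | ∃ k, v ∈ h k j s}

theorem le_limitHeard {n : ℕ} {V : Type u} (h : ℕ → Heard n V) (k : ℕ) : h k ≤ limitHeard h :=
  fun _ _ _ hv => ⟨k, hv⟩

theorem eventually_le_count {n : ℕ} {V : Type u} {h : ℕ → Heard n V} (hm : Monotone h) (s : Slot n)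
    (v : Proposal n V) :
    ∀ᶠ k in atTop, (count fun l => v ∈ limitHeard h l s) ≤ count fun l => v ∈ h k l s := by
  have h1 : ∀ᶠ k in atTop, ∀ l, v ∈ limitHeard h l s → v ∈ h k l s := by
    rw [eventually_all]
    intro l
    by_cases hv : v ∈ limitHeard h l s
    · obtain ⟨k₀, hk₀⟩ := hv
      filter_upwards [eventually_ge_atTop k₀] with k hk _
      exact hm hk l s hk₀
    · exact Eventually.of_forall fun k hk => absurd hk hv
  filter_upwards [h1] with k hk
  exact count_mono hk

/-- Acceptance depends on finitely many heard values, as processors and proposed sets are finite.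
Liveness can thus be argued in the limit knowledge and brought back to a finite time. -/
theorem Accepted.eventually {n : ℕ} {V : Type u} {t : ℕ} {h : ℕ → Heard n V} (hm : Monotone h)
    {k : ℕ} {j : Fin n} {v : Proposal n V} (H : Accepted t (limitHeard h) k j v) :
    ∀ᶠ τ in atTop, Accepted t (h τ) k j v := by
  induction k generalizing j v with
  | zero =>
    filter_upwards [eventually_le_count hm (.ready j 0) v] with τ hτ
    exact ⟨le_trans (b := count fun l => v ∈ limitHeard h l (.ready j 0)) H.1 hτ, H.2⟩
  | succ k ih =>
    obtain ⟨hd, A, hv, hA, hj, hb⟩ := H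
    have h1 : ∀ᶠ τ in atTop, ∀ b ∈ A, ∃ w, Accepted t (h τ) k b w := by
      rw [eventually_all_finset]
      intro b hbA
      obtain ⟨w, hw⟩ := hb b hbA
      exact (ih hw).mono fun τ hτ => ⟨w, hτ⟩
    filter_upwards [eventually_le_count hm (.ready j (k + 1)) v, h1] with τ hτ hτ'
    exact ⟨le_trans (b := count fun l => v ∈ limitHeard h l (.ready j (k + 1))) hd hτ,
      A, hv, hA, hj, hτ'⟩

theorem enabled_eventually {n : ℕ} {V : Type u} {t : ℕ} {i : Fin n} {a : V} {h : ℕ → Heard n V}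
    (hm : Monotone h) {s : Slot n} {v : Proposal n V} (H : v ∈ enabled t i a (limitHeard h) s) :
    ∃ τ, v ∈ enabled t i a (h τ) s := by
  match s with
  | .prop 0 => exact ⟨0, H⟩
  | .prop (k + 1) =>
    obtain ⟨A, hA, hc, hi, hb⟩ := H
    have h1 : ∀ᶠ τ in atTop, ∀ b ∈ A, ∃ w, Accepted t (h τ) k b w := by
      rw [eventually_all_finset]
      intro b hbA
      obtain ⟨w, hw⟩ := hb b hbA
      exact (hw.eventually hm).mono fun τ hτ => ⟨w, hτ⟩
    obtain ⟨τ, hτ⟩ := h1.exists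
    exact ⟨τ, A, hA, hc, hi, hτ⟩
  | .echo j k => exact H
  | .ready j k =>
    obtain ⟨τ, h1, h2⟩ := ((eventually_le_count hm (.echo j k) v).and
      (eventually_le_count hm (.ready j k) v)).exists
    exact ⟨τ, H.imp (fun H => H.trans h1) (fun H => H.trans_le h2)⟩

/-! ### Locality of the simulated states -/

theorem inputOf_eq {n : ℕ} {V : Type u} {t : ℕ} {h : Heard n V} {d : Fin n → V} {j : Fin n} {a : V}
    (hu : ∀ k j v w, Accepted t h k j v → Accepted t h k j w → v = w)
    (ha : Accepted t h 0 j (.inl a)) : inputOf t h d j = a := by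
  have hj : ∃ a, Accepted t h 0 j (.inl a) := ⟨a, ha⟩
  rw [inputOf, dif_pos hj]
  exact Sum.inl_injective (hu _ _ _ _ hj.choose_spec ha)

theorem edges_eq {n : ℕ} {V : Type u} {t : ℕ} {h : Heard n V} {k : ℕ} {j : Fin n}
    {A : Finset (Fin n)} (hu : ∀ k j v w, Accepted t h k j v → Accepted t h k j w → v = w)
    (hA : Accepted t h k j (.inr A)) : edges t h k j = A := by
  have hj : ∃ A, Accepted t h k j (.inr A) := ⟨A, hA⟩
  rw [edges, dif_pos hj]
  exact Sum.inr_injective (hu _ _ _ _ hj.choose_spec hA)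

/-- The default `Finset.univ` has both properties too, so silent processors need no separate
treatment. -/
theorem edges_spec {n : ℕ} {V : Type u} (t : ℕ) (h : Heard n V) (k : ℕ) (j : Fin n) :
    n - t ≤ (edges t h k j).card ∧ j ∈ edges t h k j := by
  unfold edges
  split_ifs with hj
  · have := hj.choose_spec
    cases k with
    | zero =>
      obtain ⟨_, a, ha⟩ := this
      cases ha
    | succ k =>
      obtain ⟨_, A, hA, hc, hi, _⟩ := this
      rw [Sum.inr_injective hA]
      exact ⟨hc, hi⟩
  · simp

theorem mem_reach_self {n : ℕ} {V : Type u} (t : ℕ) (h : Heard n V) (r : ℕ) (j : Fin n) :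
    j ∈ reach t h r j := by
  simp only [reach, Finset.mem_biUnion]
  exact ⟨j, (edges_spec t h _ j).2, j, (edges_spec t h _ j).2, (edges_spec t h _ j).2⟩

/-- Acceptance includes acceptance of all references, so partial knowledge settles the set without
recourse to the default. -/
theorem edges_local {n : ℕ} {V : Type u} {t : ℕ} {h h' : Heard n V} (hh : h ≤ h')
    (hu : ∀ k j v w, Accepted t h' k j v → Accepted t h' k j w → v = w) {k : ℕ} {j : Fin n}
    (hj : ∃ v, Accepted t h (k + 1) j v) :
    edges t h (k + 1) j = edges t h' (k + 1) j ∧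
      ∀ b ∈ edges t h (k + 1) j, ∃ w, Accepted t h k b w := by
  obtain ⟨v, hv⟩ := hj
  obtain ⟨A, rfl, -, -, hb⟩ := hv.2
  have hu' : ∀ k j v w, Accepted t h k j v → Accepted t h k j w → v = w :=
    fun k j v w H H' => hu k j v w (H.mono hh) (H'.mono hh)
  rw [edges_eq hu' hv, edges_eq hu (hv.mono hh)]
  exact ⟨rfl, hb⟩

theorem reach_local {n : ℕ} {V : Type u} {t : ℕ} {h h' : Heard n V} (hh : h ≤ h')
    (hu : ∀ k j v w, Accepted t h' k j v → Accepted t h' k j w → v = w) {r : ℕ} {j : Fin n}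
    (hj : ∃ v, Accepted t h (3 * (r + 1)) j v) :
    reach t h r j = reach t h' r j ∧ ∀ b ∈ reach t h r j, ∃ w, Accepted t h (3 * r) b w := by
  obtain ⟨e₃, a₃⟩ := edges_local (k := 3 * r + 2) hh hu hj
  have e₂ := fun a ha => edges_local (k := 3 * r + 1) hh hu (a₃ a ha)
  have e₁ := fun a ha b hb => edges_local (k := 3 * r) hh hu ((e₂ a ha).2 b hb)
  constructor
  · unfold reach
    rw [← e₃]
    refine Finset.biUnion_congr rfl fun a ha => ?_
    rw [← (e₂ a ha).1]
    exact Finset.biUnion_congr rfl fun b hb => (e₁ a ha b hb).1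
  · intro c hc
    simp only [reach, Finset.mem_biUnion] at hc
    obtain ⟨a, ha, b, hb, hc⟩ := hc
    exact (e₁ a ha b hb).2 c hc

/-- Every sender that reaches `j` is itself accepted in `h` one simulated round earlier, so
induction applies to it and the defaults `d`, `d'` are never consulted. -/
theorem simState_local {n : ℕ} {V O : Type u} (P : Protocol n V O) {t : ℕ} {h h' : Heard n V}
    (hh : h ≤ h') (hu : ∀ k j v w, Accepted t h' k j v → Accepted t h' k j w → v = w)
    (d d' : Fin n → V) {r : ℕ} {j : Fin n} (hj : ∃ v, Accepted t h (3 * r) j v) :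
    simState P t h d r j = simState P t h' d' r j := by
  induction r generalizing j with
  | zero =>
    obtain ⟨v, hv⟩ := hj
    obtain ⟨a, rfl⟩ := hv.2
    have hu' : ∀ k j v w, Accepted t h k j v → Accepted t h k j w → v = w :=
      fun k j v w H H' => hu k j v w (H.mono hh) (H'.mono hh)
    simp only [simState]
    rw [inputOf_eq hu' hv, inputOf_eq hu (hv.mono hh)]
  | succ r ih =>
    obtain ⟨e, a⟩ := reach_local hh hu hj
    simp only [simState]
    -- The previous state of `j` is covered since `j` reaches itself.
    rw [ih (a j (mem_reach_self t h r j))]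
    refine congrArg (P.step j (simState P t h' d' r j)) (funext fun l => ?_)
    rw [← e]
    split_ifs with hl
    · rw [ih (a l hl)]
    · rfl

/-! ### Asynchronous runs of the simulating protocol -/

section Run

variable {n : ℕ} {V O : Type u} {P : Protocol n V O} {t : ℕ} {x : Fin n → V} {B : Finset (Fin n)}

/-- The local state in a run of the simulating protocol. -/
def ByzRun.sim (ρ : ByzRun (simulator P t) t x B) (k : ℕ) (i : Fin n) : SimulatorState n V :=
  ρ.state k i

/-- All that `i` ever hears. -/
def ByzRun.knowledge (ρ : ByzRun (simulator P t) t x B) (i : Fin n) : Heard n V :=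
  limitHeard fun k => (ρ.sim k i).heard

/-- Processor `i` writes `v` into the register `s`. -/
def ByzRun.Writes (ρ : ByzRun (simulator P t) t x B) (i : Fin n) (s : Slot n)
    (v : Proposal n V) : Prop :=
  ∃ k, (ρ.sim k i).own s = some v

variable (ρ : ByzRun (simulator P t) t x B) {i j : Fin n}

theorem ByzRun.sim_zero (hi : i ∉ B) : ρ.sim 0 i =
    { input := x i, own := fun _ => none, heard := fun _ _ => ∅, round := 0 } :=
  ρ.state_zero i hi

theorem ByzRun.sim_succ (hi : i ∉ B) {k : ℕ} (hk : i ∈ ρ.active k) :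
    ρ.sim (k + 1) i = (ρ.sim k i).next t i (ρ.recv k i) :=
  ρ.state_active i hi k hk

theorem ByzRun.sim_idle (hi : i ∉ B) {k : ℕ} (hk : i ∉ ρ.active k) :
    ρ.sim (k + 1) i = ρ.sim k i :=
  ρ.state_idle i hi k hk

theorem ByzRun.sim_input (hi : i ∉ B) (k : ℕ) : (ρ.sim k i).input = x i := by
  induction k with
  | zero => rw [ρ.sim_zero hi]
  | succ k ih =>
    by_cases hk : i ∈ ρ.active k
    · rw [ρ.sim_succ hi hk]; exact ih
    · rw [ρ.sim_idle hi hk]; exact ih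

theorem ByzRun.heard_monotone (hi : i ∉ B) : Monotone fun k => (ρ.sim k i).heard := by
  refine monotone_nat_of_le_succ fun k => ?_
  by_cases hk : i ∈ ρ.active k
  · rw [ρ.sim_succ hi hk]
    exact fun j s => Set.subset_union_left
  · rw [ρ.sim_idle hi hk]

theorem ByzRun.own_mono (hi : i ∉ B) {s : Slot n} {v : Proposal n V} {k l : ℕ} (hkl : k ≤ l)
    (h : (ρ.sim k i).own s = some v) : (ρ.sim l i).own s = some v := by
  induction l, hkl using Nat.le_induction with
  | base => exact h
  | succ l _ ih =>
    by_cases hk : i ∈ ρ.active l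
    · rw [ρ.sim_succ hi hk]
      simp [SimulatorState.next, ih]
    · rw [ρ.sim_idle hi hk]; exact ih

theorem ByzRun.Writes.unique {ρ : ByzRun (simulator P t) t x B} (hi : i ∉ B) {s : Slot n}
    {v w : Proposal n V} (hv : ρ.Writes i s v) (hw : ρ.Writes i s w) : v = w := by
  obtain ⟨k, hk⟩ := hv
  obtain ⟨l, hl⟩ := hw
  have h1 := ρ.own_mono hi (le_max_left k l) hk
  have h2 := ρ.own_mono hi (le_max_right k l) hl
  exact Option.some.inj (h1.symm.trans h2)

/-- All registers are sent in every step, so written values eventually arrive, and correct channels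
deliver nothing else. -/
theorem ByzRun.mem_knowledge_iff (hi : i ∉ B) (hj : j ∉ B) {s : Slot n} {v : Proposal n V} :
    v ∈ ρ.knowledge i j s ↔ ρ.Writes j s v := by
  constructor
  · rintro ⟨k, hk⟩
    dsimp only at hk
    induction k with
    | zero =>
      rw [ρ.sim_zero hi] at hk
      exact hk.elim
    | succ k ih =>
      by_cases hact : i ∈ ρ.active k
      · rw [ρ.sim_succ hi hact] at hk
        rcases hk with hk | ⟨m, hm, hv⟩
        · exact ih hk
        · obtain ⟨τ, -, hs, -⟩ := ρ.genuine i j hi hj k m hact hm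
          refine ⟨τ, ?_⟩
          rw [← hv]
          exact congrFun (Option.some.inj hs) s
      · rw [ρ.sim_idle hi hact] at hk
        exact ih hk
  · rintro ⟨k, hk⟩
    obtain ⟨l, hkl, hact⟩ := ρ.fair j hj k
    obtain ⟨-, hd, hr⟩ := ρ.delivered i j hi hj l _ hact rfl
    refine ⟨ρ.deliveryTime j i l + 1, ?_⟩
    dsimp only
    rw [ρ.sim_succ hi hd]
    exact Or.inr ⟨_, hr, ρ.own_mono hj hkl hk⟩

/-- Enabledness holds from some finite time on, and the next step fills the register, possibly with
another enabled value; uniqueness arguments identify it where needed. -/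
theorem ByzRun.exists_writes (hi : i ∉ B) {s : Slot n} {v : Proposal n V}
    (hv : v ∈ enabled t i (x i) (ρ.knowledge i) s) : ∃ w, ρ.Writes i s w := by
  obtain ⟨k, hk⟩ := enabled_eventually (ρ.heard_monotone hi) hv
  obtain ⟨l, hkl, hact⟩ := ρ.fair i hi k
  have h1 : v ∈ enabled t i (x i) (ρ.sim (l + 1) i).heard s :=
    enabled_mono (ρ.heard_monotone hi (hkl.trans l.le_succ)) s hk
  have h2 : (ρ.sim (l + 1) i).own s ≠ none := by
    rw [ρ.sim_succ hi hact] at h1 ⊢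
    simp only [SimulatorState.next, ρ.sim_input hi] at h1 ⊢
    have h3 := pick_ne_none ⟨v, h1⟩
    simp [Option.or_eq_none_iff, h3]
  obtain ⟨w, hw⟩ := Option.ne_none_iff_exists'.1 h2
  exact ⟨w, l + 1, hw⟩

/-- A written value was enabled when it was written. -/
theorem ByzRun.exists_enabled (hi : i ∉ B) {s : Slot n} {v : Proposal n V} {k : ℕ}
    (hv : (ρ.sim k i).own s = some v) :
    ∃ l < k, v ∈ enabled t i (x i) (ρ.sim (l + 1) i).heard s := by
  induction k with
  | zero =>
    rw [ρ.sim_zero hi] at hv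
    cases hv
  | succ k ih =>
    have ih' := fun h => (ih h).imp fun l hl => And.imp_left Nat.lt_succ_of_lt hl
    by_cases hact : i ∈ ρ.active k
    · rw [ρ.sim_succ hi hact] at hv
      simp only [SimulatorState.next, ρ.sim_input hi, Option.or_eq_some_iff] at hv
      rcases hv with hv | ⟨-, hv⟩
      · exact ih' hv
      · refine ⟨k, k.lt_succ_self, ?_⟩
        rw [ρ.sim_succ hi hact]
        exact mem_of_pick hv
    · rw [ρ.sim_idle hi hact] at hv
      exact ih' hv

theorem ByzRun.Writes.enabled {ρ : ByzRun (simulator P t) t x B} (hi : i ∉ B) {s : Slot n}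
    {v : Proposal n V} (hv : ρ.Writes i s v) : v ∈ enabled t i (x i) (ρ.knowledge i) s := by
  obtain ⟨k, hk⟩ := hv
  obtain ⟨l, -, hl⟩ := ρ.exists_enabled hi hk
  exact enabled_mono (le_limitHeard (fun k => (ρ.sim k i).heard) (l + 1)) s hl

/-- Values heard from correct processors were written before. -/
theorem ByzRun.written_of_heard (hi : i ∉ B) (hj : j ∉ B) {s : Slot n} {v : Proposal n V} {k : ℕ}
    (hv : v ∈ (ρ.sim (k + 1) i).heard j s) : (ρ.sim k j).own s = some v := by
  induction k with
  | zero =>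
    by_cases hact : i ∈ ρ.active 0
    · rw [ρ.sim_succ hi hact] at hv
      rcases hv with hv | ⟨m, hm, hv⟩
      · rw [ρ.sim_zero hi] at hv
        exact hv.elim
      · obtain ⟨τ, ha, hs, hd⟩ := ρ.genuine i j hi hj 0 m hact hm
        have h1 := (ρ.delivered i j hi hj τ m ha hs).1
        rw [hd] at h1
        exact ρ.own_mono hj h1 ((congrFun (Option.some.inj hs) s).trans hv)
    · rw [ρ.sim_idle hi hact, ρ.sim_zero hi] at hv
      exact hv.elim
  | succ k ih =>
    by_cases hact : i ∈ ρ.active (k + 1)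
    · rw [ρ.sim_succ hi hact] at hv
      rcases hv with hv | ⟨m, hm, hv⟩
      · exact ρ.own_mono hj k.le_succ (ih hv)
      · obtain ⟨τ, ha, hs, hd⟩ := ρ.genuine i j hi hj (k + 1) m hact hm
        have h1 := (ρ.delivered i j hi hj τ m ha hs).1
        rw [hd] at h1
        exact ρ.own_mono hj h1 ((congrFun (Option.some.inj hs) s).trans hv)
    · rw [ρ.sim_idle hi hact] at hv
      exact ρ.own_mono hj k.le_succ (ih hv)

/-! ### Reliable broadcast -/

/-- The support of a correct processor goes back to a quorum of echoes. -/
theorem ByzRun.exists_echo_quorum {l : Fin n} (hl : l ∉ B) {κ : ℕ} {v : Proposal n V}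
    (hv : ρ.Writes l (.ready j κ) v) :
    ∃ i, i ∉ B ∧ n - t ≤ count fun m => v ∈ ρ.knowledge i m (.echo j κ) := by
  obtain ⟨k, hk⟩ := hv
  induction k using Nat.strong_induction_on generalizing l with
  | _ k ih =>
    obtain ⟨τ, hτ, he⟩ := ρ.exists_enabled hl hk
    rcases he with he | he
    · exact ⟨l, hl, he.trans (count_mono fun m hm => ⟨τ + 1, hm⟩)⟩
    -- One of more than `t` supporters is correct and wrote strictly earlier, so going back in time
    -- ends at an echo quorum.
    · obtain ⟨m, hm, hmv⟩ := exists_correct ρ.card_le he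
      exact ih τ hτ hm (ρ.written_of_heard hl hm hmv)

/-- Both values rest on echo quorums; these share a correct processor, whose echo register is
written once. -/
theorem ByzRun.ready_unique (hn : 3 * t < n) {l l' : Fin n} (hl : l ∉ B) (hl' : l' ∉ B) {κ : ℕ}
    {v w : Proposal n V} (hv : ρ.Writes l (.ready j κ) v) (hw : ρ.Writes l' (.ready j κ) w) :
    v = w := by
  obtain ⟨a, ha, hav⟩ := ρ.exists_echo_quorum hl hv
  obtain ⟨b, hb, hbw⟩ := ρ.exists_echo_quorum hl' hw
  obtain ⟨m, hm, h1, h2⟩ := exists_correct_of_quorums hn ρ.card_le hav hbw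
  exact ((ρ.mem_knowledge_iff ha hm).1 h1).unique hm ((ρ.mem_knowledge_iff hb hm).1 h2)

theorem ByzRun.exists_ready_of_delivered (hn : 3 * t < n) (hi : i ∉ B) {κ : ℕ} {v : Proposal n V}
    (hv : Delivered t (ρ.knowledge i) κ j v) : ∃ l, l ∉ B ∧ ρ.Writes l (.ready j κ) v := by
  unfold Delivered at hv
  obtain ⟨l, hl, h⟩ := exists_correct ρ.card_le (show t < count _ by
    exact lt_of_lt_of_le (by omega) hv)
  exact ⟨l, hl, (ρ.mem_knowledge_iff hi hl).1 h⟩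

theorem ByzRun.delivered_unique (hn : 3 * t < n) {i' : Fin n} (hi : i ∉ B) (hi' : i' ∉ B) {κ : ℕ}
    {v w : Proposal n V} (hv : Delivered t (ρ.knowledge i) κ j v)
    (hw : Delivered t (ρ.knowledge i') κ j w) : v = w := by
  obtain ⟨l, hl, h⟩ := ρ.exists_ready_of_delivered hn hi hv
  obtain ⟨l', hl', h'⟩ := ρ.exists_ready_of_delivered hn hi' hw
  exact ρ.ready_unique hn hl hl' h h'

theorem ByzRun.delivered_of_ready {i' : Fin n} (hi' : i' ∉ B) {κ : ℕ} {v : Proposal n V}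
    (h : ∀ l, l ∉ B → ρ.Writes l (.ready j κ) v) : Delivered t (ρ.knowledge i') κ j v :=
  le_count ρ.card_le fun l hl => (ρ.mem_knowledge_iff hi' hl).2 (h l hl)

/-- Among `n - t` supporters more than `t` are correct; their support reaches every correct
processor and triggers the second rule for `ready`. -/
theorem ByzRun.delivered_total (hn : 3 * t < n) {i' : Fin n} (hi : i ∉ B) (hi' : i' ∉ B) {κ : ℕ}
    {v : Proposal n V} (hv : Delivered t (ρ.knowledge i) κ j v) :
    Delivered t (ρ.knowledge i') κ j v := by
  refine ρ.delivered_of_ready hi' fun l hl => ?_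
  have h1 : t < count fun m => v ∈ ρ.knowledge l m (.ready j κ) := by
    have h2 := count_le_add ρ.card_le fun m => v ∈ ρ.knowledge i m (.ready j κ)
    have h3 : count (fun m => v ∈ ρ.knowledge i m (.ready j κ) ∧ m ∉ B) ≤
        count fun m => v ∈ ρ.knowledge l m (.ready j κ) :=
      count_mono fun m hm => (ρ.mem_knowledge_iff hl hm.2).2 ((ρ.mem_knowledge_iff hi hm.2).1 hm.1)
    unfold Delivered at hv
    omega
  obtain ⟨w, hw⟩ := ρ.exists_writes hl (s := .ready j κ) (v := v) (Or.inr h1)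
  obtain ⟨m, hm, hmv⟩ := ρ.exists_ready_of_delivered hn hi hv
  rwa [ρ.ready_unique hn hm hl hmv hw]

/-- All correct processors echo the only value that `j` proposes, and an echo quorum for another
value would contain one of them. -/
theorem ByzRun.delivered_of_writes (hn : 3 * t < n) (hi : i ∉ B) (hj : j ∉ B) {κ : ℕ}
    {v : Proposal n V} (hv : ρ.Writes j (.prop κ) v) : Delivered t (ρ.knowledge i) κ j v := by
  have echo : ∀ l, l ∉ B → ρ.Writes l (.echo j κ) v := by
    intro l hl
    obtain ⟨w, hw⟩ := ρ.exists_writes hl (s := .echo j κ) (v := v)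
      ((ρ.mem_knowledge_iff hl hj).2 hv)
    have h1 := (ρ.mem_knowledge_iff hl hj).1 (ByzRun.Writes.enabled hl hw)
    rwa [hv.unique hj h1]
  refine ρ.delivered_of_ready hi fun l hl => ?_
  obtain ⟨w, hw⟩ := ρ.exists_writes hl (s := .ready j κ) (v := v)
    (Or.inl (le_count ρ.card_le fun m hm => (ρ.mem_knowledge_iff hl hm).2 (echo m hm)))
  obtain ⟨a, ha, haw⟩ := ρ.exists_echo_quorum hl hw
  obtain ⟨m, hm, h1⟩ := exists_correct ρ.card_le
    (show t < count _ from lt_of_lt_of_le (by omega) haw)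
  rwa [(echo m hm).unique hm ((ρ.mem_knowledge_iff ha hm).1 h1)]

/-! ### Accepted proposals -/

theorem ByzRun.accepted_unique (hn : 3 * t < n) (hi : i ∉ B) (κ : ℕ) (j : Fin n)
    (v w : Proposal n V) (hv : Accepted t (ρ.knowledge i) κ j v)
    (hw : Accepted t (ρ.knowledge i) κ j w) : v = w :=
  ρ.delivered_unique hn hi hi hv.delivered hw.delivered

theorem ByzRun.accepted_total (hn : 3 * t < n) {i' : Fin n} (hi : i ∉ B) (hi' : i' ∉ B) {κ : ℕ}
    {v : Proposal n V} (hv : Accepted t (ρ.knowledge i) κ j v) :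
    Accepted t (ρ.knowledge i') κ j v := by
  induction κ generalizing j v with
  | zero => exact ⟨ρ.delivered_total hn hi hi' hv.1, hv.2⟩
  | succ κ ih =>
    obtain ⟨hd, A, hA, hc, hj, hb⟩ := hv
    exact ⟨ρ.delivered_total hn hi hi' hd, A, hA, hc, hj,
      fun b hbA => (hb b hbA).imp fun w hw => ih hw⟩

theorem ByzRun.accepted_input (hn : 3 * t < n) (hi : i ∉ B) (hj : j ∉ B) :
    Accepted t (ρ.knowledge i) 0 j (.inl (x j)) := by
  obtain ⟨w, hw⟩ := ρ.exists_writes hj (s := .prop 0) (v := .inl (x j)) rfl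
  have h1 : w = .inl (x j) := ByzRun.Writes.enabled hj hw
  rw [h1] at hw
  exact ⟨ρ.delivered_of_writes hn hi hj hw, x j, rfl⟩

theorem ByzRun.exists_accepted (hn : 3 * t < n) (hi : i ∉ B) (hj : j ∉ B) (κ : ℕ) :
    ∃ v, Accepted t (ρ.knowledge i) κ j v := by
  induction κ generalizing i j with
  | zero => exact ⟨_, ρ.accepted_input hn hi hj⟩
  | succ κ ih =>
    have h1 : (.inr Bᶜ : Proposal n V) ∈
        _root_.enabled t j (x j) (ρ.knowledge j) (.prop (κ + 1)) := by
      refine ⟨Bᶜ, rfl, ?_, by simpa using hj, fun b hb => ih hj (by simpa using hb)⟩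
      have := ρ.card_le
      rw [Finset.card_compl, Fintype.card_fin]
      omega
    obtain ⟨w, hw⟩ := ρ.exists_writes hj h1
    obtain ⟨A, hA, hc, hjA, hb⟩ := ByzRun.Writes.enabled hj hw
    exact ⟨w, ρ.delivered_of_writes hn hi hj hw, A, hA, hc, hjA,
      fun b hbA => (hb b hbA).imp fun w hw => ρ.accepted_total hn hj hi hw⟩

/-! ### The simulated rounds -/

theorem ByzRun.round_succ (hi : i ∉ B) (k : ℕ) :
    (ρ.sim (k + 1) i).round = (ρ.sim k i).round ∨
      (ρ.sim (k + 1) i).round = (ρ.sim k i).round + 1 := by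
  by_cases hk : i ∈ ρ.active k
  · rw [ρ.sim_succ hi hk]
    simp only [SimulatorState.next]
    split_ifs <;> simp
  · rw [ρ.sim_idle hi hk]
    exact Or.inl rfl

theorem ByzRun.round_monotone (hi : i ∉ B) : Monotone fun k => (ρ.sim k i).round :=
  monotone_nat_of_le_succ fun k => by rcases ρ.round_succ hi k with h | h <;> omega

/-- Round `0` is exceptional: it holds from the start, before the processor's own input is accepted.
-/
theorem ByzRun.round_accepted (hi : i ∉ B) (k : ℕ) : (ρ.sim k i).round = 0 ∨
    ∃ v, Accepted t (ρ.sim k i).heard (3 * (ρ.sim k i).round) i v := by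
  induction k with
  | zero => rw [ρ.sim_zero hi]; exact Or.inl rfl
  | succ k ih =>
    by_cases hk : i ∈ ρ.active k
    · have hm := ρ.heard_monotone hi k.le_succ
      dsimp only at hm
      rw [Nat.succ_eq_add_one] at hm
      rw [ρ.sim_succ hi hk] at hm ⊢
      by_cases h : ∃ v, Accepted t (merge (ρ.sim k i).heard (ρ.recv k i))
        (3 * ((ρ.sim k i).round + 1)) i v
      · right
        simpa only [SimulatorState.next, if_pos h] using h
      · simp only [SimulatorState.next, if_neg h] at hm ⊢
        exact ih.imp_right fun H => H.imp fun v hv => hv.mono hm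
    · rw [ρ.sim_idle hi hk]
      exact ih

/-- The processor's own proposal for phase `3 * (r + 1)` is accepted from some time on, and a later
step leaves round `r`. -/
theorem ByzRun.exists_le_round (hn : 3 * t < n) (hi : i ∉ B) (r : ℕ) :
    ∃ k, r ≤ (ρ.sim k i).round := by
  induction r with
  | zero => exact ⟨0, Nat.zero_le _⟩
  | succ r ih =>
    obtain ⟨k, hk⟩ := ih
    obtain ⟨v, hv⟩ := ρ.exists_accepted hn hi hi (3 * (r + 1))
    obtain ⟨k', hk'⟩ := (hv.eventually (ρ.heard_monotone hi)).exists
    obtain ⟨l, hl, hact⟩ := ρ.fair i hi (max k k')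
    have h1 : r ≤ (ρ.sim l i).round :=
      hk.trans (ρ.round_monotone hi ((le_max_left k k').trans hl))
    rcases h1.lt_or_eq with h1 | h1
    · exact ⟨l, h1⟩
    · refine ⟨l + 1, ?_⟩
      have h2 : Accepted t (ρ.sim (l + 1) i).heard (3 * (r + 1)) i v :=
        hk'.mono (ρ.heard_monotone hi (((le_max_right k k').trans hl).trans l.le_succ))
      rw [ρ.sim_succ hi hact] at h2 ⊢
      simp only [SimulatorState.next] at h2 ⊢
      rw [if_pos ⟨v, by rwa [← h1]⟩, ← h1]

/-- The counter grows by at most one per step, so it equals `r` when it first reaches at least `r`.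
-/
theorem ByzRun.exists_round_eq (hn : 3 * t < n) (hi : i ∉ B) (r : ℕ) :
    ∃ k, (ρ.sim k i).round = r := by
  classical
  have h := ρ.exists_le_round hn hi r
  refine ⟨Nat.find h, le_antisymm ?_ (Nat.find_spec h)⟩
  rcases hk : Nat.find h with _ | k
  · rw [ρ.sim_zero hi]
    exact Nat.zero_le _
  · have h1 := Nat.find_min h (m := k) (by omega)
    rcases ρ.round_succ hi k with h2 | h2 <;> omega

/-- Locality passes from the current to the limit knowledge of `i`; in the limit, all correct
processors accept the same proposals, so `i₀` speaks for all. -/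
theorem ByzRun.simulated_eq (hn : 3 * t < n) {i₀ : Fin n} (h₀ : i₀ ∉ B) (hi : i ∉ B) (k : ℕ) :
    (ρ.sim k i).simulated P t i =
      simState P t (ρ.knowledge i₀) x (ρ.sim k i).round i := by
  have hle : (ρ.sim k i).heard ≤ ρ.knowledge i := le_limitHeard (fun k => (ρ.sim k i).heard) k
  have hu := ρ.accepted_unique hn hi
  have h1 : simState P t (ρ.knowledge i) x (ρ.sim k i).round i =
      simState P t (ρ.knowledge i₀) x (ρ.sim k i).round i := by
    have heq : Accepted t (ρ.knowledge i) = Accepted t (ρ.knowledge i₀) := by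
      funext κ j v
      exact propext ⟨ρ.accepted_total hn hi h₀, ρ.accepted_total hn h₀ hi⟩
    have hin : inputOf t (ρ.knowledge i) = inputOf t (ρ.knowledge i₀) := by
      unfold inputOf; rw [heq]
    have hed : edges t (ρ.knowledge i) = edges t (ρ.knowledge i₀) := by
      unfold edges; rw [heq]
    have hre : reach t (ρ.knowledge i) = reach t (ρ.knowledge i₀) := by
      unfold reach; rw [hed]
    have : ∀ r, simState P t (ρ.knowledge i) x r = simState P t (ρ.knowledge i₀) x r := by
      intro r
      induction r with
      | zero => simp only [simState, hin]
      | succ r ih => simp only [simState, ih, hre]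
    rw [this]
  rw [← h1]
  unfold SimulatorState.simulated
  rcases ρ.round_accepted hi k with h | h
  · rw [h]
    by_cases ha : ∃ a, Accepted t (ρ.sim k i).heard 0 i (.inl a)
    · exact simState_local P hle hu _ _ (ha.imp' _ fun a h => h)
    -- Until its input is accepted, `i` uses it as the default, and this is the value accepted in
    -- the end.
    · simp only [simState]
      rw [inputOf_eq hu (ρ.accepted_input hn hi hi), inputOf, dif_neg ha, ρ.sim_input hi]
  · exact simState_local P hle hu _ _ h

/-- The simulated synchronous run, as `i₀` comes to know it. -/
theorem ByzRun.exists_mobRun (hn : 3 * t < n) {i₀ : Fin n} (h₀ : i₀ ∉ B) :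
    ∃ σ : MOBRun P t x B, (∀ r i, (i, i) ∉ σ.lost r) ∧
      ∀ r, σ.state r = simState P t (ρ.knowledge i₀) x r := by
  have hcore := fun r => exists_common_core hn (edges t (ρ.knowledge i₀) (3 * r + 1))
    (edges t (ρ.knowledge i₀) (3 * r + 2)) (edges t (ρ.knowledge i₀) (3 * r + 3))
    (fun j => (edges_spec t _ _ j).1) (fun j => (edges_spec t _ _ j).1)
    (fun j => (edges_spec t _ _ j).1)
  choose C hC hCr using hcore
  refine ⟨{
    card_le := ρ.card_le
    input := inputOf t (ρ.knowledge i₀) x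
    input_eq := fun i hi => inputOf_eq (ρ.accepted_unique hn h₀) (ρ.accepted_input hn h₀ hi)
    -- The omitting processors are those outside the common core.
    mobile := fun r => (C r)ᶜ
    mobile_card_le := fun r => ?_
    lost := fun r => Finset.univ.filter fun p => p.1 ∉ reach t (ρ.knowledge i₀) r p.2
    mem_mobile_of_lost := fun r j i h => ?_
    state := simState P t (ρ.knowledge i₀) x
    state_zero := fun i => rfl
    state_succ := fun r i => ?_ }, fun r i => ?_, fun r => rfl⟩
  · have := hC r
    rw [Finset.card_compl, Fintype.card_fin]
    omega
  · simp only [Finset.mem_filter, Finset.mem_univ, true_and] at h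
    exact Finset.mem_compl.2 fun hj => h (hCr r i hj)
  · simp only [simState, Finset.mem_filter, Finset.mem_univ, true_and, ite_not]
  · simp [mem_reach_self]

end Run

/-! ### Outputs under stuttering, and the conclusion -/

/-- The first output is not affected by stuttering. -/
theorem outputs_stutter_iff {α : Type*} (out : ℕ → Option α) {f : ℕ → ℕ} (hf : Monotone f)
    (hs : ∀ r, ∃ k, f k = r) (o : α) :
    (∃ k, out (f k) = some o ∧ ∀ l < k, out (f l) = none) ↔
      ∃ r, out r = some o ∧ ∀ l < r, out l = none := by
  constructor
  · rintro ⟨k, hk, hl⟩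
    refine ⟨f k, hk, fun r hr => ?_⟩
    obtain ⟨k', rfl⟩ := hs r
    exact hl k' (hf.reflect_lt hr)
  · rintro ⟨r, hr, hl⟩
    classical
    -- At the first time when `f` takes the value `r`, all earlier values are smaller.
    refine ⟨Nat.find (hs r), by rw [Nat.find_spec (hs r), hr], fun l hlt => hl _ ?_⟩
    refine lt_of_le_of_ne ?_ (Nat.find_min (hs r) hlt)
    rw [← Nat.find_spec (hs r)]
    exact hf hlt.le

theorem simulator_simulates {n t : ℕ} (hn : 3 * t < n) {V O : Type u} (P : Protocol n V O) :
    Simulates (simulator P t) P t := by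
  refine ⟨fun _ q => SimulatorState.round q, fun i q => SimulatorState.simulated P t i q,
    fun x B ρ => ?_⟩
  obtain ⟨i₀, h₀⟩ : ∃ i, i ∉ B := by
    by_contra! h
    have h1 := ρ.card_le
    rw [Finset.eq_univ_iff_forall.2 h, Finset.card_univ, Fintype.card_fin] at h1
    omega
  obtain ⟨σ, hself, hσ⟩ := ρ.exists_mobRun hn h₀
  refine ⟨σ, hself, fun i hi => ?_⟩
  have hst : ∀ k, (ρ.sim k i).simulated P t i = σ.state (ρ.sim k i).round i := fun k => by
    rw [hσ]
    exact ρ.simulated_eq hn h₀ hi k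
  refine ⟨hst, ρ.round_monotone hi, ρ.exists_round_eq hn hi, fun o => ?_⟩
  have hout : ∀ k, (simulator P t).output i (ρ.state k i) =
      P.output i (σ.state (ρ.sim k i).round i) := fun k => by
    rw [← hst k]
    rfl
  unfold Protocol.Outputs
  simp only [hout]
  exact outputs_stutter_iff (fun r => P.output i (σ.state r i)) (ρ.round_monotone hi)
    (ρ.exists_round_eq hn hi) o

theorem mainTheorem1 (n t : ℕ) (hn : 3 * t < n) (V O : Type u) :
    (∀ (P : Protocol n V O) (x : Fin n → V) (B : Finset (Fin n)) (σ : MOBRun P t x B) (R : ℕ),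
      ∃ ρ : ByzRun P t x B, ρ.StartsWith σ R) ∧
    (∀ P : Protocol n V O, ∃ Q : Protocol n V O, Simulates Q P t) :=
  ⟨fun _ _ _ σ R => σ.exists_byzRun R, fun P => ⟨simulator P t, simulator_simulates hn P⟩⟩
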